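/- Theorem 6.1. Let $0<\alpha<1$ and $\tau>0$, let $\varphi_n(x)=\sqrt{2/\pi}\,\sin(nx)$ ($n\ge 1$) be the sine basis of the (real or complex) space $L^2[0,\pi]$ with its usual norm $\|\cdot\|$ and inner product, and let $E_\alpha(z)=\sum_{k\ge 0} z^k/\Gamma(k\alpha+1)$ be the Mittag-Leffler function. For $f_0\in L^2[0,\pi]$ let $$u_\alpha(\cdot,t)=\sum_{n\ge 1}E_\alpha(-n^2t^\alpha)\langle f_0,\varphi_n\rangle\varphi_n\qquad(t>0)$$ be the solution of the time-fractional heat equation $\partial_t^\alpha u=\partial_x^2u$ on $(0,\pi)$ with zero boundary values and initial value $f_0$. For $\tilde g\in L^2[0,\pi]$ (noisy data for $g=u_\alpha(\cdot,\tau)$) and $0<t<\tau$ put $$\tilde u_\alpha(\cdot,t)=\sum_{n\ge 1}\frac{E_\alpha(-n^2t^\alpha)}{E_\alpha(-n^2\tau^\alpha)}\langle\tilde g,\varphi_n\rangle\varphi_n .$$ An index function is a continuous nondecreasing function $\varphi:(0,\infty)\to(0,\infty)$ with $\lim_{t\to0+}\varphi(t)=0$. For every $c_0>0$ there is a constant $C>0$,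 depending only on $\alpha,\tau,c_0$, such that the following holds. Let $f_0\in L^2[0,\pi]$, let $\varphi$ be an index function, and assume $$\text{(A)}\qquad \|u_\alpha(\cdot,t)-f_0\|\le c_0\,\varphi(t)\quad\text{for all }0<t<\tau .$$ Let $\psi(t)=t^\alpha\varphi(t)$ for $t>0$. Then $\psi$ is injective on $(0,\infty)$, and for all sufficiently small $\delta>0$ the number $t_\delta:=\psi^{-1}(\delta)$ exists and lies in $(0,\tau)$. Moreover, for every $\delta>0$ for which $t_\delta=\psi^{-1}(\delta)$ exists and lies in $(0,\tau)$, and for every $\tilde g\in L^2[0,\pi]$ with $\|u_\alpha(\cdot,\tau)-\tilde g\|\le\delta$, $$\|f_0-\tilde u_\alpha(\cdot,t_\delta)\|\le C\,\varphi(\psi^{-1}(\delta)).$$ In particular $\|f_0-\tilde u_\alpha(\cdot,t_\delta)\|=O(\varphi(\psi^{-1}(\delta)))$ as $\delta\to0$, uniformly in the noisy data. -/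

import Mathlib

open Set Filter Topology MeasureTheory

noncomputable section

namespace FracHeat

/-- The Mittag-Leffler function `E_α(x) = ∑_{k ≥ 0} x ^ k / Γ(k α + 1)` at real arguments. -/
def mittagLeffler (α x : ℝ) : ℝ :=
  ∑' k : ℕ, x ^ k / Real.Gamma (k * α + 1)

/-- The Hilbert space `L²[0, π]` with scalar field `𝕜` (the real or the complex numbers). -/
abbrev L2 (𝕜 : Type*) [RCLike 𝕜] : Type _ :=
  Lp 𝕜 2 ((volume : Measure ℝ).restrict (Icc 0 Real.pi))

/-- The function `x ↦ √(2/π) sin (n x)`. -/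
def sineFun (𝕜 : Type*) [RCLike 𝕜] (n : ℕ) (x : ℝ) : 𝕜 :=
  ((Real.sqrt (2 / Real.pi) * Real.sin (n * x) : ℝ) : 𝕜)

theorem memLp_sineFun (𝕜 : Type*) [RCLike 𝕜] (n : ℕ) :
    MemLp (sineFun 𝕜 n) 2 ((volume : Measure ℝ).restrict (Icc 0 Real.pi)) := by
  have hc : Continuous (sineFun 𝕜 n) := by
    unfold sineFun
    exact RCLike.continuous_ofReal.comp (by fun_prop)
  refine MemLp.of_bound hc.aestronglyMeasurable (Real.sqrt (2 / Real.pi)) (ae_of_all _ fun x => ?_)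
  rw [sineFun, RCLike.norm_ofReal, abs_mul, abs_of_nonneg (Real.sqrt_nonneg _)]
  exact mul_le_of_le_one_right (Real.sqrt_nonneg _) (Real.abs_sin_le_one _)

/-- The `n`-th eigenfunction `√(2/π) sin (n x)` as an element of `L²[0, π]`. -/
def mode (𝕜 : Type*) [RCLike 𝕜] (n : ℕ) : L2 𝕜 :=
  (memLp_sineFun 𝕜 n).toLp (sineFun 𝕜 n)

/-- The value at time `t` of the solution of the time-fractional heat equation with homogeneous
Dirichlet boundary conditions and initial value `f₀`:
`u_α(·, t) = ∑_{n ≥ 1} E_α(-n² t^α) ⟨f₀, φ_n⟩ φ_n`. -/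
def solution {𝕜 : Type*} [RCLike 𝕜] (α : ℝ) (f₀ : L2 𝕜) (t : ℝ) : L2 𝕜 :=
  ∑' n : ℕ, (((mittagLeffler α (-((n + 1 : ℕ) : ℝ) ^ 2 * t ^ α) : ℝ) : 𝕜) *
    inner 𝕜 (mode 𝕜 (n + 1)) f₀) • mode 𝕜 (n + 1)

/-- The regularized solution `R_{t,α} g` built from data `g` (exact or noisy) at the final time `τ`:
`R_{t,α} g = ∑_{n ≥ 1} (E_α(-n² t^α) / E_α(-n² τ^α)) ⟨g, φ_n⟩ φ_n`. -/
def regSolution {𝕜 : Type*} [RCLike 𝕜] (α τ : ℝ) (g : L2 𝕜) (t : ℝ) : L2 𝕜 :=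
  ∑' n : ℕ, (((mittagLeffler α (-((n + 1 : ℕ) : ℝ) ^ 2 * t ^ α) /
      mittagLeffler α (-((n + 1 : ℕ) : ℝ) ^ 2 * τ ^ α) : ℝ) : 𝕜) *
    inner 𝕜 (mode 𝕜 (n + 1)) g) • mode 𝕜 (n + 1)

/-- Index functions on `(0, ∞)`: continuous, nondecreasing, positive, with limit `0` at `0+`.
Every continuous, strictly increasing `φ : (0, ∞) → [0, ∞)` with limit `0` at `0+` is one
(its values are automatically positive). -/
structure IsIndexFunction (φ : ℝ → ℝ) : Prop where
  continuousOn : ContinuousOn φ (Ioi 0)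
  monotoneOn : MonotoneOn φ (Ioi 0)
  pos : ∀ t, 0 < t → 0 < φ t
  tendsto_zero : Tendsto φ (𝓝[>] 0) (𝓝 0)

/-- `ψ(t) = t^α φ(t)`. -/
def psi (α : ℝ) (φ : ℝ → ℝ) (t : ℝ) : ℝ := t ^ α * φ t

/-- The inverse `ψ⁻¹` of `ψ : (0, ∞) → (0, ∞)`, meaningful on the range of `ψ`. -/
def psiInv (α : ℝ) (φ : ℝ → ℝ) : ℝ → ℝ :=
  Function.invFunOn (psi α φ) (Ioi 0)

end FracHeat

end

namespace FracHeat

/-! Split the error into -(u(t) - f₀) and the regularization operator applied to the data error.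
Assumption (A) controls the first part. The second costs at most `K` (τ/t)^α δ, and δ = t^α φ(t)
turns this into `K` τ^α φ(t). Bessel's inequality suffices, so completeness of the sine system is
not needed.

The crux is that E_α(-n²t^α)/E_α(-n²τ^α) ≤ `K` (τ/t)^α uniformly in n. It follows from 1/(1 +
Γ(1-α)x) ≤ E_α(-x) ≤ 1/(1 + x/Γ(1+α)) (`mittagLeffler_neg_bounds`).

These bounds are proved by discretization. The n-th coefficient of U = (1-X)^(α-1)/((1-X)^α + l)
with l = x n^(-α) tends to E_α(-x), and sign and monotonicity arguments for power series bound it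
for each large n (`coeff_bounds_of_mul_eq`). -/

/-! ### Power series of (1 - X)^(-a) -/

/-- The `n`-th Taylor coefficient of `(1 - X) ^ (-a)`. -/
noncomputable def negBinomCoeff (a : ℝ) (n : ℕ) : ℝ :=
  ∏ i ∈ Finset.range n, (a + i) / (i + 1)

/-- The power series of `(1 - X) ^ (-a)`. -/
noncomputable def negBinomSeries (a : ℝ) : PowerSeries ℝ :=
  PowerSeries.mk (negBinomCoeff a)

theorem coeff_negBinomSeries (a : ℝ) (n : ℕ) :
    PowerSeries.coeff n (negBinomSeries a) = negBinomCoeff a n :=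
  PowerSeries.coeff_mk _ _

theorem negBinomCoeff_zero (a : ℝ) : negBinomCoeff a 0 = 1 := by simp [negBinomCoeff]

theorem negBinomCoeff_succ (a : ℝ) (n : ℕ) :
    negBinomCoeff a (n + 1) = negBinomCoeff a n * ((a + n) / (n + 1)) := by
  rw [negBinomCoeff, Finset.prod_range_succ]; rfl

theorem negBinomCoeff_one_left (n : ℕ) : negBinomCoeff 1 n = 1 := by
  induction n with
  | zero => exact negBinomCoeff_zero _
  | succ n ih =>
    rw [negBinomCoeff_succ, ih, one_mul, add_comm, div_self (by positivity)]

theorem negBinomCoeff_zero_left (n : ℕ) : negBinomCoeff 0 (n + 1) = 0 := by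
  simp [negBinomCoeff, Finset.prod_range_succ']

theorem negBinomSeries_zero : negBinomSeries 0 = 1 := by
  ext n
  rw [coeff_negBinomSeries, PowerSeries.coeff_one]
  cases n with
  | zero => simp [negBinomCoeff_zero]
  | succ n => simp [negBinomCoeff_zero_left]

theorem factorial_mul_negBinomCoeff (a : ℝ) (n : ℕ) :
    (n.factorial : ℝ) * negBinomCoeff a n = (ascPochhammer ℝ n).eval a := by
  induction n with
  | zero => simp [negBinomCoeff_zero]
  | succ n ih =>
    rw [ascPochhammer_succ_eval, ← ih, negBinomCoeff_succ, Nat.factorial_succ]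
    push_cast
    field_simp

/-- Upper negation of binomial coefficients; it transfers the Vandermonde identity to
`negBinomSeries_add`. -/
theorem negBinomSeries_eq_rescale (a : ℝ) :
    negBinomSeries a = PowerSeries.rescale (-1 : ℝ) (PowerSeries.binomialSeries ℝ (-a)) := by
  ext n
  rw [coeff_negBinomSeries, PowerSeries.coeff_rescale, PowerSeries.binomialSeries_coeff,
    Ring.choose_neg, smul_eq_mul, mul_one]
  have h : Ring.choose (a + n - 1) n = negBinomCoeff a n := by
    have hn : (n.factorial : ℝ) ≠ 0 := by positivity
    apply mul_left_cancel₀ hn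
    rw [factorial_mul_negBinomCoeff, ← nsmul_eq_mul, ← Ring.multichoose_eq,
      Ring.factorial_nsmul_multichoose_eq_ascPochhammer, Polynomial.ascPochhammer_smeval_eq_eval]
  rw [h]
  rcases Nat.even_or_odd n with hn | hn
  · rw [hn.neg_one_pow, Int.negOnePow_even _ (by exact_mod_cast hn)]
    simp
  · rw [hn.neg_one_pow, Int.negOnePow_odd _ (by exact_mod_cast hn)]
    simp

theorem negBinomSeries_add (a b : ℝ) :
    negBinomSeries (a + b) = negBinomSeries a * negBinomSeries b := by
  rw [negBinomSeries_eq_rescale, neg_add, PowerSeries.binomialSeries_add, map_mul,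
    ← negBinomSeries_eq_rescale, ← negBinomSeries_eq_rescale]

theorem negBinomCoeff_pos {a : ℝ} (ha : 0 < a) (n : ℕ) : 0 < negBinomCoeff a n :=
  Finset.prod_pos fun i _ => by positivity

theorem negBinomCoeff_neg_succ_nonpos {α : ℝ} (hα₀ : 0 < α) (hα₁ : α < 1) (n : ℕ) :
    negBinomCoeff (-α) (n + 1) ≤ 0 := by
  rw [negBinomCoeff, Finset.prod_range_succ']
  refine mul_nonpos_of_nonneg_of_nonpos (Finset.prod_nonneg fun i _ => ?_) (by simp [hα₀.le])
  push_cast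
  exact div_nonneg (by linarith [(Nat.cast_nonneg i : (0 : ℝ) ≤ i)]) (by positivity)

theorem negBinomCoeff_antitone {a : ℝ} (ha₀ : 0 < a) (ha₁ : a ≤ 1) :
    Antitone (negBinomCoeff a) := by
  refine antitone_nat_of_succ_le fun n => ?_
  rw [negBinomCoeff_succ]
  refine mul_le_of_le_one_right (negBinomCoeff_pos ha₀ n).le ?_
  rw [div_le_one (by positivity)]
  linarith

theorem coeff_negBinomSeries_one_mul (W : PowerSeries ℝ) (n : ℕ) :
    PowerSeries.coeff n (negBinomSeries 1 * W) =
      ∑ ij ∈ Finset.HasAntidiagonal.antidiagonal n, PowerSeries.coeff ij.2 W := by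
  rw [PowerSeries.coeff_mul]
  simp [coeff_negBinomSeries, negBinomCoeff_one_left]

/-! ### Coefficient bounds for the discrete problem -/

/-- The reciprocal of `(1 - X) ^ α + l` has nonnegative coefficients. -/
theorem coeff_nonneg_of_mul_eq_one {α l : ℝ} (hα₀ : 0 < α) (hα₁ : α < 1) (hl : 0 ≤ l)
    {V : PowerSeries ℝ} (hV : (negBinomSeries (-α) + PowerSeries.C l) * V = 1) (n : ℕ) :
    0 ≤ PowerSeries.coeff n V := by
  induction n using Nat.strong_induction_on with
  | _ n ih =>
    have h := congrArg (PowerSeries.coeff n) hV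
    rw [add_mul, map_add, PowerSeries.coeff_C_mul, PowerSeries.coeff_mul,
      Finset.Nat.sum_antidiagonal_eq_sum_range_succ
        (fun i j => PowerSeries.coeff i (negBinomSeries (-α)) * PowerSeries.coeff j V),
      Finset.sum_range_succ', coeff_negBinomSeries, negBinomCoeff_zero, Nat.sub_zero,
      PowerSeries.coeff_one] at h
    -- The coefficients of (1-X)^α after the leading 1 are nonpositive, so the recursion for (1 + l)
    -- vₙ has only nonnegative terms.
    have hs : ∑ k ∈ Finset.range n, PowerSeries.coeff (k + 1) (negBinomSeries (-α)) *
        PowerSeries.coeff (n - (k + 1)) V ≤ 0 := by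
      refine Finset.sum_nonpos fun k hk => mul_nonpos_of_nonpos_of_nonneg ?_ (ih _ ?_)
      · rw [coeff_negBinomSeries]
        exact negBinomCoeff_neg_succ_nonpos hα₀ hα₁ k
      · have := Finset.mem_range.1 hk
        omega
    have h1 : 0 ≤ (1 + l) * PowerSeries.coeff n V := by
      have : (0 : ℝ) ≤ if n = 0 then 1 else 0 := by split_ifs <;> norm_num
      linarith
    exact nonneg_of_mul_nonneg_right h1 (by linarith)

/-- Two-sided bounds for the coefficients of `(1 - X) ^ (α - 1) / ((1 - X) ^ α + l)`, the discrete
analogue of a Mittag-Leffler function. -/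
theorem coeff_bounds_of_mul_eq {α l : ℝ} (hα₀ : 0 < α) (hα₁ : α < 1) (hl : 0 ≤ l)
    {U : PowerSeries ℝ}
    (hU : (negBinomSeries (-α) + PowerSeries.C l) * U = negBinomSeries (1 - α)) (n : ℕ) :
    negBinomCoeff (1 - α) n ≤ (l + negBinomCoeff (1 - α) n) * PowerSeries.coeff n U ∧
      (1 + l * negBinomCoeff (α + 1) n) * PowerSeries.coeff n U ≤ 1 := by
  set D := negBinomSeries (-α) + PowerSeries.C l with hD
  have hD0 : PowerSeries.constantCoeff D ≠ 0 := by
    rw [hD, map_add, ← PowerSeries.coeff_zero_eq_constantCoeff_apply, coeff_negBinomSeries,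
      negBinomCoeff_zero, PowerSeries.constantCoeff_C]
    positivity
  obtain ⟨V, hV⟩ : ∃ V, D * V = 1 := ⟨D⁻¹, PowerSeries.mul_inv_cancel D hD0⟩
  have hv : ∀ n, 0 ≤ PowerSeries.coeff n V := coeff_nonneg_of_mul_eq_one hα₀ hα₁ hl hV
  have hUV : U = negBinomSeries (1 - α) * V := by
    calc U = (D * V) * U := by rw [hV, one_mul]
      _ = (D * U) * V := by ring
      _ = _ := by rw [hU]
  -- Since (1-X)^α V = 1 - l V, uₙ is 1 minus l times a partial sum of V; hence it decreases in n.
  have hU1 : U = negBinomSeries 1 * (1 - PowerSeries.C l * V) := by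
    rw [hUV, sub_eq_add_neg, negBinomSeries_add, ← hV, hD]
    ring
  have hu : ∀ n, PowerSeries.coeff n U =
      1 - l * ∑ ij ∈ Finset.HasAntidiagonal.antidiagonal n, PowerSeries.coeff ij.2 V := by
    intro n
    rw [hU1, mul_sub, mul_one, map_sub, coeff_negBinomSeries, negBinomCoeff_one_left,
      coeff_negBinomSeries_one_mul]
    simp [PowerSeries.coeff_C_mul, Finset.mul_sum]
  have hanti : Antitone fun n => PowerSeries.coeff n U := by
    refine antitone_nat_of_succ_le fun n => ?_
    have := mul_nonneg hl (hv (n + 1))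
    rw [hu, hu, Finset.Nat.sum_antidiagonal_succ]
    simp only
    linarith
  constructor
  · have h1 : negBinomCoeff (1 - α) n * ∑ ij ∈ Finset.HasAntidiagonal.antidiagonal n, PowerSeries.coeff ij.2 V ≤
        PowerSeries.coeff n U := by
      rw [hUV, PowerSeries.coeff_mul, Finset.mul_sum]
      refine Finset.sum_le_sum fun ij hij => mul_le_mul_of_nonneg_right ?_ (hv _)
      rw [coeff_negBinomSeries]
      exact negBinomCoeff_antitone (by linarith) (by linarith) (by
        have := Finset.HasAntidiagonal.mem_antidiagonal.1 hij; omega)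
    have h2 := mul_le_mul_of_nonneg_left h1 hl
    have h3 := hu n
    linear_combination h2 - negBinomCoeff (1 - α) n * h3
  · have h1 : U + PowerSeries.C l * (negBinomSeries α * U) = negBinomSeries 1 := by
      have h2 : negBinomSeries α * negBinomSeries (1 - α) = negBinomSeries 1 := by
        rw [← negBinomSeries_add]; congr 1; ring
      have h3 : negBinomSeries α * negBinomSeries (-α) = 1 := by
        rw [← negBinomSeries_add, add_neg_cancel, negBinomSeries_zero]
      rw [← h2, ← hU, hD]
      linear_combination (-U) * h3
    have h2 := congrArg (PowerSeries.coeff n) h1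
    rw [map_add, PowerSeries.coeff_C_mul, coeff_negBinomSeries, negBinomCoeff_one_left] at h2
    have h3 : negBinomCoeff (α + 1) n * PowerSeries.coeff n U ≤
        PowerSeries.coeff n (negBinomSeries α * U) := by
      rw [← coeff_negBinomSeries, negBinomSeries_add, mul_comm (negBinomSeries α) (negBinomSeries 1),
        coeff_negBinomSeries_one_mul, Finset.sum_mul, mul_comm (negBinomSeries α) U,
        PowerSeries.coeff_mul]
      refine Finset.sum_le_sum fun ij hij => ?_
      rw [coeff_negBinomSeries, mul_comm (PowerSeries.coeff ij.1 U)]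
      exact mul_le_mul_of_nonneg_left (hanti (by
        have := Finset.HasAntidiagonal.mem_antidiagonal.1 hij; omega)) (negBinomCoeff_pos hα₀ _).le
    have := mul_le_mul_of_nonneg_left h3 hl
    linarith

/-! ### Geometric expansion and passage to the limit -/

theorem negBinomCoeff_natCast_succ (k n : ℕ) :
    negBinomCoeff ((k : ℝ) + 1) n = ((k + n).choose n : ℝ) := by
  induction n with
  | zero => simp [negBinomCoeff_zero]
  | succ n ih =>
    have h : ((k + n + 1 : ℕ) : ℝ) * ((k + n).choose n : ℝ) =
        ((k + n + 1).choose (n + 1) : ℝ) * ((n + 1 : ℕ) : ℝ) := by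
      exact_mod_cast Nat.add_one_mul_choose_eq (k + n) n
    rw [negBinomCoeff_succ, ih, ← add_assoc]
    push_cast at h
    field_simp
    linear_combination h

/-- Growth 2^k in k makes the series converge, with ratio 1/2, once |l| ≤ 1/4. -/
theorem negBinomCoeff_le_two_pow {α : ℝ} (hα₀ : 0 ≤ α) (hα₁ : α ≤ 1) (k n : ℕ) :
    negBinomCoeff (k * α + 1) n ≤ 2 ^ n * 2 ^ k := by
  have h1 : negBinomCoeff (k * α + 1) n ≤ negBinomCoeff ((k : ℝ) + 1) n := by
    refine Finset.prod_le_prod (fun i _ => by positivity) fun i _ => ?_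
    gcongr
    exact mul_le_of_le_one_right (Nat.cast_nonneg k) hα₁
  refine h1.trans ?_
  rw [negBinomCoeff_natCast_succ, ← pow_add, add_comm n k]
  exact_mod_cast Nat.choose_le_two_pow (k + n) n

theorem summable_pow_mul_negBinomCoeff {α l : ℝ} (hα₀ : 0 ≤ α) (hα₁ : α ≤ 1) (hl : |l| ≤ 1 / 4)
    (n : ℕ) : Summable fun k : ℕ => |l| ^ k * negBinomCoeff (k * α + 1) n := by
  have hg : Summable fun k : ℕ => (2 : ℝ) ^ n * (1 / 2 : ℝ) ^ k :=
    (summable_geometric_of_lt_one (by norm_num) (by norm_num)).mul_left _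
  refine hg.of_nonneg_of_le (fun k => ?_) fun k => ?_
  · exact mul_nonneg (by positivity) (negBinomCoeff_pos (by positivity) n).le
  · calc |l| ^ k * negBinomCoeff (k * α + 1) n
        ≤ (1 / 4) ^ k * (2 ^ n * 2 ^ k) :=
          mul_le_mul (pow_le_pow_left₀ (abs_nonneg l) hl k) (negBinomCoeff_le_two_pow hα₀ hα₁ k n)
            (negBinomCoeff_pos (by positivity) n).le (by positivity)
      _ = 2 ^ n * (1 / 2 : ℝ) ^ k := by
        rw [mul_left_comm, ← mul_pow]; norm_num

theorem summable_neg_pow_mul_negBinomCoeff {α l : ℝ} (hα₀ : 0 ≤ α) (hα₁ : α ≤ 1)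
    (hl : |l| ≤ 1 / 4) (n : ℕ) :
    Summable fun k : ℕ => (-l) ^ k * negBinomCoeff (k * α + 1) n := by
  refine (summable_pow_mul_negBinomCoeff hα₀ hα₁ hl n).of_norm_bounded fun k => ?_
  rw [norm_mul, norm_pow, norm_neg, Real.norm_eq_abs, Real.norm_eq_abs,
    abs_of_pos (negBinomCoeff_pos (by positivity) n)]

/-- The geometric series expansion of `(1 - X) ^ (α - 1) / ((1 - X) ^ α + l)`. -/
noncomputable def discreteMittagLeffler (α l : ℝ) : PowerSeries ℝ :=
  PowerSeries.mk fun n => ∑' k : ℕ, (-l) ^ k * negBinomCoeff (k * α + 1) n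

/-- Multiplying by (1-X)^α shifts k to k - 1, so the sum telescopes and only the k = 0 term
survives. -/
theorem mul_discreteMittagLeffler {α l : ℝ} (hα₀ : 0 ≤ α) (hα₁ : α ≤ 1) (hl : |l| ≤ 1 / 4) :
    (negBinomSeries (-α) + PowerSeries.C l) * discreteMittagLeffler α l =
      negBinomSeries (1 - α) := by
  ext n
  have hsum := summable_neg_pow_mul_negBinomCoeff hα₀ hα₁ hl
  have hconv : ∀ k : ℕ, ∑ ij ∈ Finset.HasAntidiagonal.antidiagonal n, negBinomCoeff (-α) ij.1 *
      ((-l) ^ k * negBinomCoeff (k * α + 1) ij.2) =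
      (-l) ^ k * negBinomCoeff (-α + (k * α + 1)) n := by
    intro k
    rw [← coeff_negBinomSeries (-α + _), negBinomSeries_add, PowerSeries.coeff_mul, Finset.mul_sum]
    refine Finset.sum_congr rfl fun ij _ => ?_
    rw [coeff_negBinomSeries, coeff_negBinomSeries]
    ring
  have h1 : HasSum (fun k : ℕ => (-l) ^ k * negBinomCoeff (-α + (k * α + 1)) n)
      (∑ ij ∈ Finset.HasAntidiagonal.antidiagonal n, negBinomCoeff (-α) ij.1 *
        ∑' k : ℕ, (-l) ^ k * negBinomCoeff (k * α + 1) ij.2) := by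
    simp_rw [← hconv]
    exact hasSum_sum fun ij _ => (hsum ij.2).hasSum.mul_left _
  rw [add_mul, map_add, PowerSeries.coeff_C_mul, PowerSeries.coeff_mul]
  simp only [discreteMittagLeffler, PowerSeries.coeff_mk, coeff_negBinomSeries]
  rw [← h1.tsum_eq, h1.summable.tsum_eq_zero_add, ← tsum_mul_left, add_assoc,
    ← Summable.tsum_add ((summable_nat_add_iff 1).2 h1.summable) ((hsum n).mul_left l)]
  have h0 : ∀ k : ℕ, (-l) ^ (k + 1) * negBinomCoeff (-α + ((k + 1 : ℕ) * α + 1)) n +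
      l * ((-l) ^ k * negBinomCoeff (k * α + 1) n) = 0 := by
    intro k
    have : -α + (((k + 1 : ℕ) : ℝ) * α + 1) = k * α + 1 := by push_cast; ring
    rw [this]
    ring
  simp_rw [h0]
  simp [neg_add_eq_sub]

/-- Amounts to 1 + s/(n+1) ≤ (1 + 1/n)^s. It provides a majorant independent of n for dominated
convergence. -/
theorem negBinomCoeff_mul_rpow_inv_antitone {s : ℝ} (hs : 0 ≤ s) {m n : ℕ} (hm : 1 ≤ m)
    (hmn : m ≤ n) :
    negBinomCoeff (s + 1) n * ((n : ℝ) ^ s)⁻¹ ≤ negBinomCoeff (s + 1) m * ((m : ℝ) ^ s)⁻¹ := by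
  induction n, hmn using Nat.le_induction with
  | base => exact le_rfl
  | succ n hmn ih =>
    refine le_trans ?_ ih
    have hn : (0 : ℝ) < n := by exact_mod_cast (show 0 < n by omega)
    have hc := negBinomCoeff_pos (show 0 < s + 1 by positivity) n
    have hlog : 1 / ((n : ℝ) + 1) ≤ Real.log ((n + 1) / n) := by
      refine le_trans (le_of_eq ?_) (Real.one_sub_inv_le_log_of_pos (by positivity))
      field_simp
      ring
    have hratio : (s + 1 + n) / (n + 1) ≤ ((n + 1 : ℝ) / n) ^ s := by
      rw [Real.rpow_def_of_pos (by positivity)]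
      have h1 := Real.add_one_le_exp (Real.log (((n : ℝ) + 1) / n) * s)
      have h2 := mul_le_mul_of_nonneg_right hlog hs
      have h3 : (s + 1 + n) / ((n : ℝ) + 1) = 1 / ((n : ℝ) + 1) * s + 1 := by
        field_simp
        ring
      linarith
    rw [Real.div_rpow (by positivity) hn.le] at hratio
    rw [negBinomCoeff_succ, mul_assoc]
    refine mul_le_mul_of_nonneg_left ?_ hc.le
    push_cast
    have hp : (0 : ℝ) < ((n : ℝ) + 1) ^ s := by positivity
    calc (s + 1 + n) / ((n : ℝ) + 1) * (((n : ℝ) + 1) ^ s)⁻¹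
        ≤ ((n : ℝ) + 1) ^ s / (n : ℝ) ^ s * (((n : ℝ) + 1) ^ s)⁻¹ := by gcongr
      _ = ((n : ℝ) ^ s)⁻¹ := by field_simp

/-- Euler's limit formula for Γ(s), multiplied by s; this is why s = 0 is separate. -/
theorem tendsto_negBinomCoeff_mul_rpow_inv {s : ℝ} (hs : -1 < s) :
    Tendsto (fun n : ℕ => negBinomCoeff (s + 1) n * ((n : ℝ) ^ s)⁻¹) atTop
      (𝓝 (Real.Gamma (s + 1))⁻¹) := by
  rcases eq_or_ne s 0 with rfl | hs0
  · simp [negBinomCoeff_one_left]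
  have hΓ : Real.Gamma (s + 1) ≠ 0 := (Real.Gamma_pos_of_pos (by linarith)).ne'
  have h := ((Real.GammaSeq_tendsto_Gamma s).const_mul s)
  rw [← Real.Gamma_add_one hs0] at h
  refine (h.inv₀ hΓ).congr fun n => ?_
  rw [Real.GammaSeq, Finset.prod_range_succ', negBinomCoeff, Finset.prod_div_distrib]
  have h1 : ∏ i ∈ Finset.range n, ((i : ℝ) + 1) = (n.factorial : ℝ) := by
    exact_mod_cast Finset.prod_range_add_one_eq_factorial n
  have h2 : ∏ i ∈ Finset.range n, (s + ((i + 1 : ℕ) : ℝ)) = ∏ i ∈ Finset.range n, (s + 1 + i) :=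
    Finset.prod_congr rfl fun i _ => by push_cast; ring
  rw [h1, h2, Nat.cast_zero, add_zero, mul_inv, inv_div]
  field_simp

theorem tendsto_mul_natCast_rpow_inv {α : ℝ} (hα : 0 < α) (x : ℝ) :
    Tendsto (fun n : ℕ => x * ((n : ℝ) ^ α)⁻¹) atTop (𝓝 0) := by
  have := ((tendsto_rpow_atTop hα).comp tendsto_natCast_atTop_atTop).inv_tendsto_atTop
  simpa using this.const_mul x

theorem tendsto_coeff_discreteMittagLeffler {α x : ℝ} (hα₀ : 0 < α) (hα₁ : α ≤ 1) (hx : 0 ≤ x) :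
    Tendsto (fun n : ℕ => PowerSeries.coeff n (discreteMittagLeffler α (x * ((n : ℝ) ^ α)⁻¹)))
      atTop (𝓝 (mittagLeffler α (-x))) := by
  have hsmall := tendsto_mul_natCast_rpow_inv hα₀ x
  -- The terms at this fixed index m are summable and dominate those at all n ≥ m.
  obtain ⟨m, hm1, hm⟩ : ∃ m : ℕ, 1 ≤ m ∧ x * ((m : ℝ) ^ α)⁻¹ ≤ 1 / 4 :=
    ((eventually_ge_atTop 1).and (hsmall.eventually_le_const (by norm_num))).exists
  have hpow : ∀ (n k : ℕ), ((((n : ℝ) ^ α)⁻¹) ^ k) = ((n : ℝ) ^ (k * α))⁻¹ := by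
    intro n k
    rw [inv_pow, ← Real.rpow_natCast, ← Real.rpow_mul (Nat.cast_nonneg n), mul_comm]
  have hterm : ∀ (n k : ℕ), (-(x * ((n : ℝ) ^ α)⁻¹)) ^ k * negBinomCoeff (k * α + 1) n =
      (-x) ^ k * (negBinomCoeff (k * α + 1) n * ((n : ℝ) ^ (k * α))⁻¹) := by
    intro n k
    rw [← neg_mul, mul_pow, hpow]
    ring
  have hbound : Summable fun k : ℕ =>
      x ^ k * (negBinomCoeff (k * α + 1) m * ((m : ℝ) ^ (k * α))⁻¹) := by
    have h0 : 0 ≤ x * ((m : ℝ) ^ α)⁻¹ := by positivity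
    refine (summable_pow_mul_negBinomCoeff hα₀.le hα₁ (l := x * ((m : ℝ) ^ α)⁻¹)
      (by rwa [abs_of_nonneg h0]) m).congr fun k => ?_
    rw [abs_of_nonneg h0, mul_pow, hpow]
    ring
  simp only [discreteMittagLeffler, PowerSeries.coeff_mk, hterm, mittagLeffler, div_eq_mul_inv]
  refine tendsto_tsum_of_dominated_convergence hbound (fun k => ?_) ?_
  · have hk : (0 : ℝ) ≤ k * α := by positivity
    exact (tendsto_negBinomCoeff_mul_rpow_inv (by linarith)).const_mul _
  · filter_upwards [eventually_ge_atTop m] with n hn k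
    have hk : (0 : ℝ) ≤ k * α := by positivity
    have hc := negBinomCoeff_pos (show 0 < k * α + 1 by positivity) n
    rw [norm_mul, norm_pow, norm_neg, Real.norm_of_nonneg hx, Real.norm_of_nonneg (by positivity)]
    gcongr ?_ * ?_
    exact negBinomCoeff_mul_rpow_inv_antitone hk hm1 hn

/-! ### Bounds for the Mittag-Leffler function -/

/-- Two-sided bounds for the Mittag-Leffler function on the negative half-line. -/
theorem mittagLeffler_neg_bounds {α x : ℝ} (hα₀ : 0 < α) (hα₁ : α < 1) (hx : 0 ≤ x) :
    1 ≤ (1 + Real.Gamma (1 - α) * x) * mittagLeffler α (-x) ∧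
      (1 + x / Real.Gamma (α + 1)) * mittagLeffler α (-x) ≤ 1 := by
  have hlim := tendsto_coeff_discreteMittagLeffler hα₀ hα₁.le hx
  have hsmall := tendsto_mul_natCast_rpow_inv hα₀ x
  have hb : ∀ᶠ n : ℕ in atTop, 1 ≤ n ∧ (negBinomSeries (-α) +
      PowerSeries.C (x * ((n : ℝ) ^ α)⁻¹)) * discreteMittagLeffler α (x * ((n : ℝ) ^ α)⁻¹) =
        negBinomSeries (1 - α) := by
    filter_upwards [eventually_ge_atTop 1,
      hsmall.eventually_le_const (show (0 : ℝ) < 1 / 4 by norm_num)] with n hn1 hn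
    exact ⟨hn1, mul_discreteMittagLeffler hα₀.le hα₁.le (by rwa [abs_of_nonneg (by positivity)])⟩
  constructor
  · have hΓ : 0 < Real.Gamma (1 - α) := Real.Gamma_pos_of_pos (by linarith)
    have hg := tendsto_negBinomCoeff_mul_rpow_inv (s := -α) (by linarith)
    rw [neg_add_eq_sub] at hg
    have h := le_of_tendsto_of_tendsto hg ((hg.const_add x).mul hlim) (by
      filter_upwards [hb] with n hn
      have hn0 : (0 : ℝ) < n := by exact_mod_cast hn.1
      have h1 := (coeff_bounds_of_mul_eq hα₀ hα₁ (by positivity) hn.2 n).1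
      have hp : 0 < (n : ℝ) ^ α := by positivity
      rw [Real.rpow_neg hn0.le, inv_inv]
      have h2 := mul_le_mul_of_nonneg_right h1 hp.le
      refine h2.trans (le_of_eq ?_)
      field_simp)
    have h2 := mul_le_mul_of_nonneg_left h hΓ.le
    rw [mul_inv_cancel₀ hΓ.ne'] at h2
    refine h2.trans (le_of_eq ?_)
    field_simp
    ring
  · have hg := (tendsto_negBinomCoeff_mul_rpow_inv (s := α) (by linarith)).const_mul x
    refine le_of_tendsto ((hg.const_add 1).mul hlim) ?_
    filter_upwards [hb] with n hn
    refine le_trans (le_of_eq ?_) (coeff_bounds_of_mul_eq hα₀ hα₁ (by positivity) hn.2 n).2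
    ring

theorem mittagLeffler_neg_pos {α x : ℝ} (hα₀ : 0 < α) (hα₁ : α < 1) (hx : 0 ≤ x) :
    0 < mittagLeffler α (-x) := by
  have hΓ : 0 < Real.Gamma (1 - α) := Real.Gamma_pos_of_pos (by linarith)
  exact pos_of_mul_pos_right (one_pos.trans_le (mittagLeffler_neg_bounds hα₀ hα₁ hx).1)
    (by positivity)

theorem mittagLeffler_neg_le_one {α x : ℝ} (hα₀ : 0 < α) (hα₁ : α < 1) (hx : 0 ≤ x) :
    mittagLeffler α (-x) ≤ 1 := by
  have hΓ : 0 < Real.Gamma (α + 1) := Real.Gamma_pos_of_pos (by linarith)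
  refine le_trans ?_ (mittagLeffler_neg_bounds hα₀ hα₁ hx).2
  exact le_mul_of_one_le_left (mittagLeffler_neg_pos hα₀ hα₁ hx).le
    (le_add_of_nonneg_right (by positivity))

/-- Quotients of Mittag-Leffler values grow at most linearly in the dilation factor. -/
theorem mittagLeffler_neg_div_le {α x r : ℝ} (hα₀ : 0 < α) (hα₁ : α < 1) (hx : 0 ≤ x)
    (hr : 1 ≤ r) :
    mittagLeffler α (-x) / mittagLeffler α (-(r * x)) ≤
      (1 + Real.Gamma (1 - α) * Real.Gamma (α + 1)) * r := by
  set A := Real.Gamma (1 - α)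
  set B := Real.Gamma (α + 1)
  have hA : 0 < A := Real.Gamma_pos_of_pos (by linarith)
  have hB : 0 < B := Real.Gamma_pos_of_pos (by linarith)
  have hy : 0 ≤ r * x := by positivity
  have hEy := mittagLeffler_neg_pos hα₀ hα₁ hy
  have hEx := mittagLeffler_neg_pos hα₀ hα₁ hx
  have hlow := (mittagLeffler_neg_bounds hα₀ hα₁ hy).1
  have hup := (mittagLeffler_neg_bounds hα₀ hα₁ hx).2
  rw [div_le_iff₀ hEy]
  set p := mittagLeffler α (-x)
  set q := mittagLeffler α (-(r * x))
  -- The term A r x equals A B r (x/B), and r ≥ 1 absorbs the 1.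
  have h1 : 1 + A * (r * x) ≤ (1 + A * B) * r * (1 + x / B) := by
    have : (1 + A * B) * r * (1 + x / B) = r + r * (x / B) + A * B * r + A * (r * x) := by
      field_simp
      ring
    rw [this]
    have : 0 ≤ r * (x / B) := by positivity
    have : 0 ≤ A * B * r := by positivity
    linarith
  have h2 : 1 ≤ (1 + A * B) * r * (1 + x / B) * q :=
    hlow.trans (mul_le_mul_of_nonneg_right h1 hEy.le)
  have h3 : 0 < 1 + x / B := by positivity
  refine le_of_mul_le_mul_left ?_ h3
  calc (1 + x / B) * p ≤ 1 := hup
    _ ≤ _ := h2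
    _ = _ := by ring

/-! ### Bounded multipliers on an orthonormal system -/

section Multiplier

variable {𝕜 E ι : Type*} [RCLike 𝕜] [NormedAddCommGroup E] [InnerProductSpace 𝕜 E] {e : ι → E}

theorem norm_sum_multiplier_le (he : Orthonormal 𝕜 e) {m : ι → ℝ} {M : ℝ} (hM : 0 ≤ M)
    (hm : ∀ i, |m i| ≤ M) (g : E) (s : Finset ι) :
    ‖∑ i ∈ s, ((m i : 𝕜) * inner 𝕜 (e i) g) • e i‖ ≤ M * ‖g‖ := by
  refine le_of_sq_le_sq ?_ (by positivity)
  have h := he.orthogonalFamily.norm_sum (fun i => (m i : 𝕜) * inner 𝕜 (e i) g) s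
  simp only [LinearIsometry.toSpanSingleton_apply] at h
  rw [h, mul_pow]
  calc ∑ i ∈ s, ‖(m i : 𝕜) * inner 𝕜 (e i) g‖ ^ 2
      ≤ ∑ i ∈ s, M ^ 2 * ‖inner 𝕜 (e i) g‖ ^ 2 := by
        refine Finset.sum_le_sum fun i _ => ?_
        rw [norm_mul, mul_pow, RCLike.norm_ofReal]
        gcongr
        exact hm i
    _ = M ^ 2 * ∑ i ∈ s, ‖inner 𝕜 (e i) g‖ ^ 2 := by rw [Finset.mul_sum]
    _ ≤ M ^ 2 * ‖g‖ ^ 2 := by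
        gcongr
        exact he.sum_inner_products_le g

theorem summable_multiplier [CompleteSpace E] (he : Orthonormal 𝕜 e) {m : ι → ℝ} {M : ℝ}
    (hm : ∀ i, |m i| ≤ M) (g : E) :
    Summable fun i => ((m i : 𝕜) * inner 𝕜 (e i) g) • e i := by
  have h := (he.orthogonalFamily.summable_iff_norm_sq_summable
    (fun i => (m i : 𝕜) * inner 𝕜 (e i) g)).2 (by
      refine ((he.inner_products_summable g).mul_left (M ^ 2)).of_nonneg_of_le
        (fun i => by positivity) fun i => ?_
      rw [norm_mul, mul_pow, RCLike.norm_ofReal]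
      gcongr
      exact hm i)
  simpa only [LinearIsometry.toSpanSingleton_apply] using h

theorem norm_tsum_multiplier_le [CompleteSpace E] (he : Orthonormal 𝕜 e) {m : ι → ℝ} {M : ℝ}
    (hM : 0 ≤ M) (hm : ∀ i, |m i| ≤ M) (g : E) :
    ‖∑' i, ((m i : 𝕜) * inner 𝕜 (e i) g) • e i‖ ≤ M * ‖g‖ :=
  le_of_tendsto (summable_multiplier he hm g).hasSum.norm
    (Eventually.of_forall fun s => norm_sum_multiplier_le he hM hm g s)

theorem inner_tsum_multiplier [CompleteSpace E] (he : Orthonormal 𝕜 e) {m : ι → ℝ} {M : ℝ}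
    (hm : ∀ i, |m i| ≤ M) (g : E) (j : ι) :
    inner 𝕜 (e j) (∑' i, ((m i : 𝕜) * inner 𝕜 (e i) g) • e i) =
      (m j : 𝕜) * inner 𝕜 (e j) g := by
  classical
  have h := (summable_multiplier he hm g).hasSum.mapL (innerSL 𝕜 (e j))
  simp only [innerSL_apply_apply, inner_smul_right, orthonormal_iff_ite.1 he] at h
  rw [← h.tsum_eq, tsum_eq_single j fun i hi => by simp [hi.symm]]
  simp

end Multiplier

/-! ### Orthonormality of the sine modes -/

theorem integral_cos_int_mul (k : ℤ) :
    ∫ x in (0 : ℝ)..Real.pi, Real.cos (k * x) = if k = 0 then Real.pi else 0 := by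
  split_ifs with hk
  · simp [hk]
  · have hk' : (k : ℝ) ≠ 0 := by exact_mod_cast hk
    rw [intervalIntegral.integral_comp_mul_left (fun x => Real.cos x) hk', integral_cos]
    simp [Real.sin_int_mul_pi]

theorem integral_sin_mul_sin (m n : ℕ) :
    ∫ x in (0 : ℝ)..Real.pi, Real.sin ((m + 1 : ℕ) * x) * Real.sin ((n + 1 : ℕ) * x) =
      if m = n then Real.pi / 2 else 0 := by
  have h : ∀ x : ℝ, Real.sin ((m + 1 : ℕ) * x) * Real.sin ((n + 1 : ℕ) * x) =
      2⁻¹ * (Real.cos (((m : ℤ) - n : ℤ) * x) - Real.cos (((m : ℤ) + n + 2 : ℤ) * x)) := by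
    intro x
    have h1 := Real.cos_sub ((m + 1 : ℕ) * x) ((n + 1 : ℕ) * x)
    have h2 := Real.cos_add ((m + 1 : ℕ) * x) ((n + 1 : ℕ) * x)
    have e1 : (((m : ℤ) - n : ℤ) : ℝ) * x = (m + 1 : ℕ) * x - (n + 1 : ℕ) * x := by
      push_cast; ring
    have e2 : (((m : ℤ) + n + 2 : ℤ) : ℝ) * x = (m + 1 : ℕ) * x + (n + 1 : ℕ) * x := by
      push_cast; ring
    rw [e1, e2, h1, h2]
    ring
  simp_rw [h]
  rw [intervalIntegral.integral_const_mul, intervalIntegral.integral_sub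
    ((by fun_prop : Continuous _).intervalIntegrable _ _)
    ((by fun_prop : Continuous _).intervalIntegrable _ _),
    integral_cos_int_mul, integral_cos_int_mul, if_neg (show (m : ℤ) + n + 2 ≠ 0 by omega)]
  have : ((m : ℤ) - n = 0) ↔ m = n := by omega
  simp only [this]
  split_ifs <;> ring

theorem orthonormal_mode (𝕜 : Type*) [RCLike 𝕜] :
    Orthonormal 𝕜 fun n : ℕ => mode 𝕜 (n + 1) := by
  rw [orthonormal_iff_ite]
  intro m n
  rw [L2.inner_def]
  have h : (fun x => inner 𝕜 ((mode 𝕜 (m + 1) : ℝ → 𝕜) x) ((mode 𝕜 (n + 1) : ℝ → 𝕜) x))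
      =ᵐ[(volume : Measure ℝ).restrict (Icc 0 Real.pi)] fun x =>
        ((2 / Real.pi * (Real.sin ((m + 1 : ℕ) * x) * Real.sin ((n + 1 : ℕ) * x)) : ℝ) : 𝕜) := by
    filter_upwards [(memLp_sineFun 𝕜 (m + 1)).coeFn_toLp, (memLp_sineFun 𝕜 (n + 1)).coeFn_toLp]
      with x h1 h2
    rw [mode, mode, h1, h2, sineFun, sineFun, RCLike.inner_apply, RCLike.conj_ofReal,
      ← RCLike.ofReal_mul]
    congr 1
    have := Real.mul_self_sqrt (show 0 ≤ 2 / Real.pi by positivity)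
    linear_combination Real.sin ((m + 1 : ℕ) * x) * Real.sin ((n + 1 : ℕ) * x) * this
  rw [integral_congr_ae h, integral_ofReal, integral_Icc_eq_integral_Ioc,
    ← intervalIntegral.integral_of_le Real.pi_pos.le, intervalIntegral.integral_const_mul,
    integral_sin_mul_sin]
  split_ifs
  · have : (2 / Real.pi * (Real.pi / 2) : ℝ) = 1 := by field_simp
    rw [this, RCLike.ofReal_one]
  · simp

/-! ### The function ψ and its inverse -/

theorem IsIndexFunction.psi_strictMonoOn {α : ℝ} {φ : ℝ → ℝ} (hφ : IsIndexFunction φ)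
    (hα : 0 < α) : StrictMonoOn (psi α φ) (Ioi 0) := fun s hs _ ht hst =>
  mul_lt_mul (Real.rpow_lt_rpow (le_of_lt hs) hst hα) (hφ.monotoneOn hs ht hst.le) (hφ.pos s hs)
    (Real.rpow_nonneg (le_of_lt ht) _)

theorem IsIndexFunction.psi_continuousOn {α : ℝ} {φ : ℝ → ℝ} (hφ : IsIndexFunction φ)
    (hα : 0 < α) : ContinuousOn (psi α φ) (Ioi 0) :=
  (Real.continuous_rpow_const hα.le).continuousOn.mul hφ.continuousOn

theorem IsIndexFunction.psi_tendsto_zero {α : ℝ} {φ : ℝ → ℝ} (hφ : IsIndexFunction φ)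
    (hα : 0 < α) : Tendsto (psi α φ) (𝓝[>] 0) (𝓝 0) := by
  have h : Tendsto (fun t : ℝ => t ^ α) (𝓝[>] 0) (𝓝 0) := by
    have := (Real.continuous_rpow_const hα.le).tendsto (0 : ℝ)
    rw [Real.zero_rpow hα.ne'] at this
    exact this.mono_left nhdsWithin_le_nhds
  have := h.mul hφ.tendsto_zero
  rwa [mul_zero] at this

theorem IsIndexFunction.psiInv_psi {α : ℝ} {φ : ℝ → ℝ} (hφ : IsIndexFunction φ) (hα : 0 < α)
    {t : ℝ} (ht : 0 < t) : psiInv α φ (psi α φ t) = t :=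
  (hφ.psi_strictMonoOn hα).injOn.leftInvOn_invFunOn ht

theorem IsIndexFunction.exists_psi_eq {α : ℝ} {φ : ℝ → ℝ} (hφ : IsIndexFunction φ) (hα : 0 < α)
    {t δ : ℝ} (ht : 0 < t) (hδ₀ : 0 < δ) (hδ : δ < psi α φ t) : ∃ s ∈ Ioo 0 t, psi α φ s = δ := by
  obtain ⟨r, hrδ, hr0, hrt⟩ : ∃ r, psi α φ r < δ ∧ r ∈ Ioo 0 t :=
    (((hφ.psi_tendsto_zero hα).eventually_lt_const hδ₀).and (Ioo_mem_nhdsGT ht)).exists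
  obtain ⟨s, hs, rfl⟩ := intermediate_value_Ioo hrt.le
    ((hφ.psi_continuousOn hα).mono fun x hx => hr0.trans_le hx.1) ⟨hrδ, hδ⟩
  exact ⟨s, ⟨hr0.trans hs.1, hs.2⟩, rfl⟩

/-! ### The regularization operator -/

variable {𝕜 : Type*} [RCLike 𝕜] {α τ t : ℝ}

theorem abs_mittagLeffler_mode_le_one (hα₀ : 0 < α) (hα₁ : α < 1) (ht : 0 ≤ t) (n : ℕ) :
    |mittagLeffler α (-((n + 1 : ℕ) : ℝ) ^ 2 * t ^ α)| ≤ 1 := by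
  have hx : 0 ≤ ((n + 1 : ℕ) : ℝ) ^ 2 * t ^ α := by positivity
  rw [neg_mul, abs_of_pos (mittagLeffler_neg_pos hα₀ hα₁ hx)]
  exact mittagLeffler_neg_le_one hα₀ hα₁ hx

theorem abs_mittagLeffler_mode_div_le (hα₀ : 0 < α) (hα₁ : α < 1) (ht : 0 < t) (htτ : t ≤ τ)
    (n : ℕ) :
    |mittagLeffler α (-((n + 1 : ℕ) : ℝ) ^ 2 * t ^ α) /
      mittagLeffler α (-((n + 1 : ℕ) : ℝ) ^ 2 * τ ^ α)| ≤
      (1 + Real.Gamma (1 - α) * Real.Gamma (α + 1)) * (τ / t) ^ α := by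
  have hτ : 0 < τ := ht.trans_le htτ
  have hx : 0 ≤ ((n + 1 : ℕ) : ℝ) ^ 2 * t ^ α := by positivity
  have hy : 0 ≤ ((n + 1 : ℕ) : ℝ) ^ 2 * τ ^ α := by positivity
  have hr : 1 ≤ (τ / t) ^ α := Real.one_le_rpow ((one_le_div ht).2 htτ) hα₀.le
  have hxy : ((n + 1 : ℕ) : ℝ) ^ 2 * τ ^ α = (τ / t) ^ α * (((n + 1 : ℕ) : ℝ) ^ 2 * t ^ α) := by
    rw [Real.div_rpow hτ.le ht.le]
    field_simp
  rw [neg_mul, neg_mul, abs_of_pos (div_pos (mittagLeffler_neg_pos hα₀ hα₁ hx)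
    (mittagLeffler_neg_pos hα₀ hα₁ hy)), hxy]
  exact mittagLeffler_neg_div_le hα₀ hα₁ hx hr

theorem regSolution_sub (hα₀ : 0 < α) (hα₁ : α < 1) (ht : 0 < t) (htτ : t ≤ τ) (g g' : L2 𝕜) :
    regSolution α τ (g - g') t = regSolution α τ g t - regSolution α τ g' t := by
  have hs := summable_multiplier (orthonormal_mode 𝕜)
    (abs_mittagLeffler_mode_div_le hα₀ hα₁ ht htτ)
  rw [regSolution, regSolution, regSolution, ← (hs g).tsum_sub (hs g')]
  simp only [inner_sub_right, mul_sub, sub_smul]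

/-- The regularization is exact on exact data. -/
theorem regSolution_solution (hα₀ : 0 < α) (hα₁ : α < 1) (hτ : 0 < τ) (f₀ : L2 𝕜) :
    regSolution α τ (solution α f₀ τ) t = solution α f₀ t := by
  have hinner (n : ℕ) : inner 𝕜 (mode 𝕜 (n + 1)) (solution α f₀ τ) =
      (mittagLeffler α (-((n + 1 : ℕ) : ℝ) ^ 2 * τ ^ α) : 𝕜) * inner 𝕜 (mode 𝕜 (n + 1)) f₀ :=
    inner_tsum_multiplier (orthonormal_mode 𝕜)
      (abs_mittagLeffler_mode_le_one hα₀ hα₁ hτ.le) f₀ n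
  refine tsum_congr fun n => ?_
  have hE : mittagLeffler α (-((n + 1 : ℕ) : ℝ) ^ 2 * τ ^ α) ≠ 0 := by
    rw [neg_mul]
    exact (mittagLeffler_neg_pos hα₀ hα₁ (by positivity)).ne'
  rw [hinner, ← mul_assoc, ← RCLike.ofReal_mul, div_mul_cancel₀ _ hE]

theorem norm_regSolution_le (hα₀ : 0 < α) (hα₁ : α < 1) (ht : 0 < t) (htτ : t ≤ τ) (g : L2 𝕜) :
    ‖regSolution α τ g t‖ ≤
      (1 + Real.Gamma (1 - α) * Real.Gamma (α + 1)) * (τ / t) ^ α * ‖g‖ :=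
  norm_tsum_multiplier_le (orthonormal_mode 𝕜)
    ((abs_nonneg _).trans (abs_mittagLeffler_mode_div_le hα₀ hα₁ ht htτ 0))
    (abs_mittagLeffler_mode_div_le hα₀ hα₁ ht htτ) g

end FracHeat

/-! ### The error estimate -/

theorem theorem6p1 (𝕜 : Type*) [RCLike 𝕜] (α τ c₀ : ℝ)
    (hα₀ : 0 < α) (hα₁ : α < 1) (hτ : 0 < τ) (hc₀ : 0 < c₀) :
    ∃ C : ℝ, 0 < C ∧
      ∀ (f₀ : FracHeat.L2 𝕜) (φ : ℝ → ℝ), FracHeat.IsIndexFunction φ →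
        (∀ t ∈ Set.Ioo 0 τ, ‖FracHeat.solution α f₀ t - f₀‖ ≤ c₀ * φ t) →
        Set.InjOn (FracHeat.psi α φ) (Set.Ioi 0) ∧
        (∃ δ₀ : ℝ, 0 < δ₀ ∧ ∀ δ ∈ Set.Ioo 0 δ₀,
          FracHeat.psiInv α φ δ ∈ Set.Ioo 0 τ ∧
          FracHeat.psi α φ (FracHeat.psiInv α φ δ) = δ) ∧
        ∀ δ ∈ FracHeat.psi α φ '' Set.Ioo 0 τ, ∀ g' : FracHeat.L2 𝕜,
          ‖FracHeat.solution α f₀ τ - g'‖ ≤ δ →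
          ‖f₀ - FracHeat.regSolution α τ g' (FracHeat.psiInv α φ δ)‖
            ≤ C * φ (FracHeat.psiInv α φ δ) := by
  set K := 1 + Real.Gamma (1 - α) * Real.Gamma (α + 1) with hK
  have hK0 : 0 < K := by
    have h1 : 0 < Real.Gamma (1 - α) := Real.Gamma_pos_of_pos (by linarith)
    have h2 : 0 < Real.Gamma (α + 1) := Real.Gamma_pos_of_pos (by linarith)
    positivity
  -- The two summands of C come from (A) and from noise amplification. The threshold ψ(τ) works
  -- since ψ takes every value in (0, ψ(τ)) on (0, τ).
  refine ⟨c₀ + K * τ ^ α, by positivity, fun f₀ φ hφ hA =>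
    ⟨(hφ.psi_strictMonoOn hα₀).injOn, ⟨FracHeat.psi α φ τ, ?_, ?_⟩, ?_⟩⟩
  · have := hφ.pos τ hτ
    unfold FracHeat.psi
    positivity
  · rintro δ ⟨hδ0, hδ⟩
    obtain ⟨t, ht, rfl⟩ := hφ.exists_psi_eq hα₀ hτ hδ0 hδ
    rw [hφ.psiInv_psi hα₀ ht.1]
    exact ⟨ht, rfl⟩
  · rintro _ ⟨t, ht, rfl⟩ g' hg'
    rw [hφ.psiInv_psi hα₀ ht.1]
    have ht0 : 0 < t := ht.1
    have h1 : f₀ - FracHeat.regSolution α τ g' t = -(FracHeat.solution α f₀ t - f₀) +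
        FracHeat.regSolution α τ (FracHeat.solution α f₀ τ - g') t := by
      rw [FracHeat.regSolution_sub hα₀ hα₁ ht0 ht.2.le,
        FracHeat.regSolution_solution hα₀ hα₁ hτ]
      abel
    rw [h1]
    refine (norm_add_le _ _).trans ?_
    rw [norm_neg, add_mul]
    refine add_le_add (hA t ht) ((FracHeat.norm_regSolution_le hα₀ hα₁ ht0 ht.2.le _).trans ?_)
    rw [← hK]
    refine (mul_le_mul_of_nonneg_left hg' (by positivity)).trans (le_of_eq ?_)
    rw [FracHeat.psi, Real.div_rpow hτ.le ht0.le]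
    have : t ^ α ≠ 0 := (Real.rpow_pos_of_pos ht0 α).ne'
    field_simp
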